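/- Let $d\ge 1$ be an integer, and let $\mathcal M_m^+(\mathbb R^d)$ be the set of finite positive Radon measures $\mu$ on $\mathbb R^d$ with $M_\mu:=\mu(\mathbb R^d)>0$ and $\int|x|^m\,d\mu(x)<\infty$. For $\mu\in\mathcal M_2^+(\mathbb R^d)$ let $\vec m_\mu:=\frac1{M_\mu}\int x\,d\mu(x)$ be its barycenter, and let $\bar\mu_0$ be the centered normalized measure, that is, $\frac1{M_\mu}$ times the push-forward of $\mu$ under $x\mapsto x-\vec m_\mu$. For probability measures $\mu,\nu$ on $\mathbb R^d$ put $$d_2(\mu,\nu):=\sup_{\xi\ne0}\frac{|\widehat\mu(\xi)-\widehat\nu(\xi)|}{|\xi|^2},\qquad \widehat\mu(\xi):=\int_{\mathbb R^d}e^{-ix\cdot\xi}\,d\mu(x),$$ $$W_2(\mu,\nu):=\inf_{\pi\in\Pi(\mu,\nu)}\Bigl(\int_{\mathbb R^d\times\mathbb R^d}|x-y|^2\,d\pi(x,y)\Bigr)^{1/2},$$ where $\Pi(\mu,\nu)$ is the set of probability measures on $\mathbb R^d\times\mathbb R^d$ with marginals $\mu$ and $\nu$. For $\mu,\nu\in\mathcal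 M_2^+(\mathbb R^d)$ put $$\widetilde d_2(\mu,\nu):=d_2(\bar\mu_0,\bar\nu_0)+|\vec m_\mu-\vec m_\nu|+|M_\mu-M_\nu|,$$ $$\widetilde W_2(\mu,\nu):=W_2(\bar\mu_0,\bar\nu_0)+|\vec m_\mu-\vec m_\nu|+|M_\mu-M_\nu|.$$ Proposition. Let $\rho>0$ and $M>0$. There exist constants $c,C>0$ and an exponent $0<q<1$, depending only on $d,\rho,M$, such that for all $\mu,\nu\in\mathcal M_{2+\rho}^+(\mathbb R^d)$ with $$\frac1{M_\mu}\int_{\mathbb R^d}|x-\vec m_\mu|^{2+\rho}\,d\mu(x)\le M,\qquad \frac1{M_\nu}\int_{\mathbb R^d}|x-\vec m_\nu|^{2+\rho}\,d\nu(x)\le M,$$ the quantities $\widetilde d_2(\mu,\nu)$ and $\widetilde W_2(\mu,\nu)$ are finite and $$c\,\widetilde d_2(\mu,\nu)\le\widetilde W_2(\mu,\nu)\le C\bigl(\widetilde d_2(\mu,\nu)^q+\widetilde d_2(\mu,\nu)\bigr).$$ -/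

import Mathlib

open MeasureTheory
open scoped ENNReal

noncomputable section

/-- The Euclidean space `ℝ^d`. -/
abbrev Rd (d : ℕ) : Type := EuclideanSpace ℝ (Fin d)

/-- `μ ∈ 𝓜_m⁺(ℝ^d)`: a finite positive Borel measure on `ℝ^d` (automatically Radon) with positive
total mass and finite absolute moment of order `m`. -/
structure IsPosMeasureWithMoment {d : ℕ} (m : ℝ) (μ : Measure (Rd d)) : Prop where
  mass_lt_top : μ Set.univ < ∞
  mass_pos : 0 < μ Set.univ
  moment_lt_top : ∫⁻ x, ‖x‖ₑ ^ m ∂μ < ∞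

/-- The total mass `M_μ = μ(ℝ^d)`, as a real number. -/
def totalMass {d : ℕ} (μ : Measure (Rd d)) : ℝ := μ.real Set.univ

/-- The barycenter `(1 / M_μ) ∫ x dμ(x)`. -/
def barycenter {d : ℕ} (μ : Measure (Rd d)) : Rd d := (totalMass μ)⁻¹ • ∫ x, x ∂μ

/-- The centered normalized measure `μ̄₀`: the image of `μ` under `x ↦ x - barycenter μ`, divided by
the total mass. -/
def centeredNormalized {d : ℕ} (μ : Measure (Rd d)) : Measure (Rd d) :=
  (μ Set.univ)⁻¹ • μ.map (fun x => x - barycenter μ)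

/-- The Fourier transform `∫ e^{-i x·ξ} dμ(x)`. -/
def fourierMeasure {d : ℕ} (μ : Measure (Rd d)) (ξ : Rd d) : ℂ :=
  ∫ x, Complex.exp (-(Complex.I * ((inner ℝ x ξ : ℝ) : ℂ))) ∂μ

/-- The Fourier distance `d₂`, with values in `[0, ∞]`. -/
def fourierDist {d : ℕ} (μ ν : Measure (Rd d)) : ℝ≥0∞ :=
  ⨆ (ξ : Rd d) (_ : ξ ≠ 0), ‖fourierMeasure μ ξ - fourierMeasure ν ξ‖ₑ / ‖ξ‖ₑ ^ 2

/-- The couplings of `μ` and `ν`: probability measures with marginals `μ` and `ν`. -/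
def couplings {d : ℕ} (μ ν : Measure (Rd d)) : Set (Measure (Rd d × Rd d)) :=
  {π | IsProbabilityMeasure π ∧ π.map Prod.fst = μ ∧ π.map Prod.snd = ν}

/-- The 2-Wasserstein distance `W₂`, with values in `[0, ∞]`. -/
def wassersteinDist {d : ℕ} (μ ν : Measure (Rd d)) : ℝ≥0∞ :=
  ⨅ π ∈ couplings μ ν, (∫⁻ z, ‖z.1 - z.2‖ₑ ^ 2 ∂π) ^ (1 / 2 : ℝ)

/-- The generalized Fourier distance
`d₂(μ̄₀, ν̄₀) + |barycenter μ - barycenter ν| + |M_μ - M_ν|`. -/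
def genFourierDist {d : ℕ} (μ ν : Measure (Rd d)) : ℝ≥0∞ :=
  fourierDist (centeredNormalized μ) (centeredNormalized ν)
    + ENNReal.ofReal ‖barycenter μ - barycenter ν‖
    + ENNReal.ofReal |totalMass μ - totalMass ν|

/-- The generalized Wasserstein distance
`W₂(μ̄₀, ν̄₀) + |barycenter μ - barycenter ν| + |M_μ - M_ν|`. -/
def genWassersteinDist {d : ℕ} (μ ν : Measure (Rd d)) : ℝ≥0∞ :=
  wassersteinDist (centeredNormalized μ) (centeredNormalized ν)
    + ENNReal.ofReal ‖barycenter μ - barycenter ν‖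
    + ENNReal.ofReal |totalMass μ - totalMass ν|

end

/-! The barycenter and mass terms occur in both generalized distances, so everything reduces to
comparing `d₂` and `W₂` for centered probability measures whose moment of order `2 + ρ` is at most
`M`; their second moments are then at most `1 + M`.

`d₂ ≲ W₂`: since both means vanish, `e^{-ix·ξ}` may be replaced by `e^{-ix·ξ} + i x·ξ`, whose
increments are quadratic in `ξ`. Integrating against any coupling and applying Cauchy–Schwarz gives
`fourierDist_le_mul_wassersteinDist`.

`W₂ ≲ d₂^q + d₂`: add Gaussian noise of size `s` to both measures. By Fourier inversion the smoothed
densities differ pointwise by at most a multiple of `s^{-(d+2)} d₂`. If `d₂ ≤ s^{2d+4}`, integrating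
this over the ball of radius `1/s` and using second moments outside it shows that the two noisy laws
share all but `O(s²)` of their mass (`exists_lintegral_smoothedDensity_tsub_le`). The originals are
coupled through the shared noisy point, at cost `O(s²)`, and independently on the rest
(`exists_coupling_of_common_part`). Truncating the rest at radius `s^{-1/2}` bounds its cost by
`O(s^{min(1, ρ/2)})`, thanks to the higher moment. The choice `s = d₂^{1/(2d+4)}` gives the power
when `d₂ ≤ 1`; for `d₂ ≥ 1` the product coupling already suffices. -/

open ProbabilityTheory

/-- The function `t ↦ e^{-it} + it` has derivative of size at most `|t|`, hence this Lipschitz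
estimate. -/
lemma norm_exp_neg_I_mul_add_sub_le (a b : ℝ) :
    ‖(Complex.exp (-(Complex.I * (a : ℂ))) + Complex.I * a)
      - (Complex.exp (-(Complex.I * (b : ℂ))) + Complex.I * b)‖ ≤ |a - b| * (|a| + |b|) := by
  have hderiv : ∀ t ∈ Set.uIcc b a, HasDerivWithinAt
      (fun t : ℝ => Complex.exp (-(Complex.I * (t : ℂ))) + Complex.I * t)
      (Complex.exp (-(Complex.I * (t : ℂ))) * (-Complex.I) + Complex.I) (Set.uIcc b a) t := by
    intro t _
    have h0 : HasDerivAt (fun t : ℝ => Complex.I * (t : ℂ)) Complex.I t := by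
      simpa using (Complex.ofRealCLM.hasDerivAt (x := t)).const_mul Complex.I
    exact (h0.neg.cexp.add h0).hasDerivWithinAt
  have hbound : ∀ t ∈ Set.uIcc b a,
      ‖Complex.exp (-(Complex.I * (t : ℂ))) * (-Complex.I) + Complex.I‖ ≤ |a| + |b| := by
    intro t ht
    have h1 : Complex.exp (-(Complex.I * (t : ℂ))) * (-Complex.I) + Complex.I
        = (-Complex.I) * (Complex.exp (Complex.I * ((-t : ℝ) : ℂ)) - 1) := by
      have h2 : Complex.I * ((-t : ℝ) : ℂ) = -(Complex.I * (t : ℂ)) := by push_cast; ring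
      rw [h2]
      ring
    rw [h1, norm_mul, norm_neg, Complex.norm_I, one_mul]
    refine Real.norm_exp_I_mul_ofReal_sub_one_le.trans ?_
    rw [norm_neg, Real.norm_eq_abs]
    rcases Set.mem_uIcc.1 ht with h | h <;> rw [abs_le] <;>
      constructor <;> linarith [neg_abs_le a, neg_abs_le b, le_abs_self a, le_abs_self b,
        abs_nonneg a, abs_nonneg b]
  have := (convex_uIcc b a).norm_image_sub_le_of_norm_hasDerivWithin_le hderiv hbound
    Set.left_mem_uIcc Set.right_mem_uIcc
  rw [Real.norm_eq_abs] at this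
  linarith

/-! ### Second moments and the product coupling. -/

section Moments

variable {d : ℕ}

lemma ENNReal.add_sq_le_two_mul (a b : ℝ≥0∞) : (a + b) ^ 2 ≤ 2 * a ^ 2 + 2 * b ^ 2 := by
  have h := ENNReal.rpow_add_le_mul_rpow_add_rpow a b (p := 2) (by norm_num)
  have h1 : (2 : ℝ≥0∞) ^ ((2 : ℝ) - 1) = 2 := by norm_num
  rw [h1] at h
  simpa [mul_add] using h

lemma enorm_sub_sq_le (x y : Rd d) : ‖x - y‖ₑ ^ 2 ≤ 2 * ‖x‖ₑ ^ 2 + 2 * ‖y‖ₑ ^ 2 :=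
  (pow_le_pow_left₀ zero_le enorm_sub_le 2).trans (ENNReal.add_sq_le_two_mul _ _)

lemma integrable_id_of_lintegral_enorm_sq_lt_top {μ : Measure (Rd d)} [IsFiniteMeasure μ]
    (h : ∫⁻ x, ‖x‖ₑ ^ 2 ∂μ < ∞) : Integrable (fun x => x) μ := by
  refine ⟨measurable_id.aestronglyMeasurable, ?_⟩
  rw [HasFiniteIntegral]
  calc ∫⁻ x, ‖x‖ₑ ∂μ ≤ ∫⁻ x, (1 + ‖x‖ₑ ^ 2) ∂μ := by
        refine lintegral_mono fun x => ?_
        rcases le_total ‖x‖ₑ 1 with h1 | h1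
        · exact h1.trans le_self_add
        · exact (le_self_pow₀ h1 two_ne_zero).trans le_add_self
    _ = μ Set.univ + ∫⁻ x, ‖x‖ₑ ^ 2 ∂μ := by
        rw [lintegral_add_left measurable_const, lintegral_one]
    _ < ∞ := ENNReal.add_lt_top.2 ⟨measure_lt_top _ _, h⟩

lemma lintegral_enorm_sq_le_mass_add {ρ : ℝ} (hρ : 0 < ρ) (μ : Measure (Rd d)) :
    ∫⁻ x, ‖x‖ₑ ^ 2 ∂μ ≤ μ Set.univ + ∫⁻ x, ‖x‖ₑ ^ (2 + ρ) ∂μ := by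
  calc ∫⁻ x, ‖x‖ₑ ^ 2 ∂μ ≤ ∫⁻ x, (1 + ‖x‖ₑ ^ (2 + ρ)) ∂μ := by
        refine lintegral_mono fun x => ?_
        rcases le_total ‖x‖ₑ 1 with h1 | h1
        · exact (pow_le_one₀ zero_le h1).trans le_self_add
        · refine le_trans ?_ le_add_self
          rw [← ENNReal.rpow_two]
          exact ENNReal.rpow_le_rpow_of_exponent_le h1 (by linarith)
    _ = μ Set.univ + ∫⁻ x, ‖x‖ₑ ^ (2 + ρ) ∂μ := by
        rw [lintegral_add_left measurable_const, lintegral_one]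

lemma lintegral_enorm_sq_le_one_add {ρ : ℝ} (hρ : 0 < ρ) {μ : Measure (Rd d)}
    [IsProbabilityMeasure μ] {m : ℝ≥0∞} (h : ∫⁻ x, ‖x‖ₑ ^ (2 + ρ) ∂μ ≤ m) :
    ∫⁻ x, ‖x‖ₑ ^ 2 ∂μ ≤ 1 + m := by
  refine (lintegral_enorm_sq_le_mass_add hρ μ).trans ?_
  rw [measure_univ]
  gcongr

/-- The product coupling bounds the Wasserstein distance by the second moments. -/
lemma wassersteinDist_le_of_moments {μ ν : Measure (Rd d)} [IsProbabilityMeasure μ]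
    [IsProbabilityMeasure ν] {B : ℝ≥0∞} (hμ : ∫⁻ x, ‖x‖ₑ ^ 2 ∂μ ≤ B)
    (hν : ∫⁻ x, ‖x‖ₑ ^ 2 ∂ν ≤ B) : wassersteinDist μ ν ≤ (4 * B) ^ (1 / 2 : ℝ) := by
  have hc : μ.prod ν ∈ couplings μ ν := by
    refine ⟨inferInstance, ?_, ?_⟩
    · rw [Measure.map_fst_prod, measure_univ, one_smul]
    · rw [Measure.map_snd_prod, measure_univ, one_smul]
  refine (iInf₂_le (μ.prod ν) hc).trans ?_
  gcongr
  calc ∫⁻ z, ‖z.1 - z.2‖ₑ ^ 2 ∂(μ.prod ν)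
      ≤ ∫⁻ z, (2 * ‖z.1‖ₑ ^ 2 + 2 * ‖z.2‖ₑ ^ 2) ∂(μ.prod ν) :=
        lintegral_mono fun z => enorm_sub_sq_le _ _
    _ = 2 * ∫⁻ x, ‖x‖ₑ ^ 2 ∂μ + 2 * ∫⁻ x, ‖x‖ₑ ^ 2 ∂ν := by
        rw [lintegral_add_left (by fun_prop), lintegral_const_mul _ (by fun_prop),
          lintegral_const_mul _ (by fun_prop),
          ← lintegral_map (μ := μ.prod ν) (f := fun x : Rd d => ‖x‖ₑ ^ 2) (by fun_prop)
            measurable_fst,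
          ← lintegral_map (μ := μ.prod ν) (f := fun x : Rd d => ‖x‖ₑ ^ 2) (by fun_prop)
            measurable_snd, Measure.map_fst_prod, Measure.map_snd_prod]
        simp
    _ ≤ 2 * B + 2 * B := by gcongr
    _ = 4 * B := by ring

/-! ### Bounding `d₂` by `W₂` for centered measures. -/

lemma norm_exp_neg_I_mul_inner (x ξ : Rd d) :
    ‖Complex.exp (-(Complex.I * ((inner ℝ x ξ : ℝ) : ℂ)))‖ = 1 := by
  have : -(Complex.I * ((inner ℝ x ξ : ℝ) : ℂ)) = Complex.I * ((-inner ℝ x ξ : ℝ) : ℂ) := by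
    push_cast; ring
  rw [this, Complex.norm_exp_I_mul_ofReal]

lemma integrable_exp_neg_I_mul_inner (μ : Measure (Rd d)) [IsFiniteMeasure μ] (ξ : Rd d) :
    Integrable (fun x => Complex.exp (-(Complex.I * ((inner ℝ x ξ : ℝ) : ℂ)))) μ := by
  refine Integrable.of_bound (C := 1) (Continuous.aestronglyMeasurable (by fun_prop)) ?_
  exact Filter.Eventually.of_forall fun x => (norm_exp_neg_I_mul_inner x ξ).le

/-- For centred measures the linear term can be added to the Fourier transform for free. -/
lemma fourierMeasure_eq_of_mean_zero {μ : Measure (Rd d)} [IsFiniteMeasure μ]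
    (hint : Integrable (fun x => x) μ) (h0 : ∫ x, x ∂μ = 0) (ξ : Rd d) :
    fourierMeasure μ ξ = ∫ x, (Complex.exp (-(Complex.I * ((inner ℝ x ξ : ℝ) : ℂ)))
      + Complex.I * ((inner ℝ x ξ : ℝ) : ℂ)) ∂μ := by
  have hi : Integrable (fun x : Rd d => (inner ℝ x ξ : ℝ)) μ := hint.inner_const ξ
  have hi' : Integrable (fun x : Rd d => ((inner ℝ x ξ : ℝ) : ℂ)) μ := hi.ofReal
  rw [integral_add (integrable_exp_neg_I_mul_inner μ ξ) (hi'.const_mul Complex.I),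
    integral_const_mul, integral_complex_ofReal]
  have : ∫ x, (inner ℝ x ξ : ℝ) ∂μ = 0 := by
    simp_rw [real_inner_comm ξ]
    rw [integral_inner hint, h0, inner_zero_right]
  rw [this, fourierMeasure]
  simp

/-- With the free linear term added, the integrand gains a second factor `|ξ|`: its increment is at
most `|ξ|² |x - y| (|x| + |y|)`. Cauchy–Schwarz separates the transport cost from the second
moments. -/
lemma fourierMeasure_sub_enorm_le_of_coupling {μ ν : Measure (Rd d)} [IsProbabilityMeasure μ]
    [IsProbabilityMeasure ν] {B : ℝ≥0∞} (hB : B < ∞) (hμ : ∫⁻ x, ‖x‖ₑ ^ 2 ∂μ ≤ B)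
    (hν : ∫⁻ x, ‖x‖ₑ ^ 2 ∂ν ≤ B) (hμ0 : ∫ x, x ∂μ = 0) (hν0 : ∫ x, x ∂ν = 0)
    {π : Measure (Rd d × Rd d)} (hπ : π ∈ couplings μ ν) (ξ : Rd d) :
    ‖fourierMeasure μ ξ - fourierMeasure ν ξ‖ₑ ≤
      ‖ξ‖ₑ ^ 2 * ((∫⁻ z, ‖z.1 - z.2‖ₑ ^ 2 ∂π) ^ (1 / 2 : ℝ) * (4 * B) ^ (1 / 2 : ℝ)) := by
  obtain ⟨hπp, h1, h2⟩ := hπ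
  have iμ := integrable_id_of_lintegral_enorm_sq_lt_top (hμ.trans_lt hB)
  have iν := integrable_id_of_lintegral_enorm_sq_lt_top (hν.trans_lt hB)
  set G : Rd d → ℂ := fun x => Complex.exp (-(Complex.I * ((inner ℝ x ξ : ℝ) : ℂ)))
      + Complex.I * ((inner ℝ x ξ : ℝ) : ℂ) with hG
  have hGc : Continuous G := by fun_prop
  have gμ : Integrable G μ :=
    (integrable_exp_neg_I_mul_inner μ ξ).add ((iμ.inner_const ξ).ofReal.const_mul _)
  have gν : Integrable G ν :=
    (integrable_exp_neg_I_mul_inner ν ξ).add ((iν.inner_const ξ).ofReal.const_mul _)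
  rw [fourierMeasure_eq_of_mean_zero iμ hμ0, fourierMeasure_eq_of_mean_zero iν hν0]
  have e1 : ∫ x, G x ∂μ = ∫ z, G z.1 ∂π := by
    rw [← h1, integral_map measurable_fst.aemeasurable hGc.aestronglyMeasurable]
  have e2 : ∫ x, G x ∂ν = ∫ z, G z.2 ∂π := by
    rw [← h2, integral_map measurable_snd.aemeasurable hGc.aestronglyMeasurable]
  have g1 : Integrable (fun z : Rd d × Rd d => G z.1) π := by
    rw [← h1] at gμ; exact gμ.comp_measurable measurable_fst
  have g2 : Integrable (fun z : Rd d × Rd d => G z.2) π := by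
    rw [← h2] at gν; exact gν.comp_measurable measurable_snd
  rw [e1, e2, ← integral_sub g1 g2]
  refine (enorm_integral_le_lintegral_enorm _).trans ?_
  have hpt : ∀ z : Rd d × Rd d, ‖G z.1 - G z.2‖ₑ ≤
      ‖ξ‖ₑ ^ 2 * (‖z.1 - z.2‖ₑ * (‖z.1‖ₑ + ‖z.2‖ₑ)) := by
    intro z
    have hr : ‖G z.1 - G z.2‖ ≤ ‖ξ‖ ^ 2 * (‖z.1 - z.2‖ * (‖z.1‖ + ‖z.2‖)) := by
      refine (norm_exp_neg_I_mul_add_sub_le _ _).trans ?_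
      rw [← inner_sub_left]
      calc |inner ℝ (z.1 - z.2) ξ| * (|inner ℝ z.1 ξ| + |inner ℝ z.2 ξ|)
          ≤ (‖z.1 - z.2‖ * ‖ξ‖) * (‖z.1‖ * ‖ξ‖ + ‖z.2‖ * ‖ξ‖) := by
            gcongr <;> exact abs_real_inner_le_norm _ _
        _ = _ := by ring
    have h := ENNReal.ofReal_le_ofReal hr
    rw [ENNReal.ofReal_mul (by positivity), ENNReal.ofReal_mul (by positivity),
      ENNReal.ofReal_add (by positivity) (by positivity),
      ENNReal.ofReal_pow (by positivity)] at h
    simpa using h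
  refine (lintegral_mono hpt).trans ?_
  rw [lintegral_const_mul _ (by fun_prop)]
  gcongr
  have hH := ENNReal.lintegral_mul_le_Lp_mul_Lq π Real.HolderConjugate.two_two
    (f := fun z : Rd d × Rd d => ‖z.1 - z.2‖ₑ) (g := fun z => ‖z.1‖ₑ + ‖z.2‖ₑ)
    (by fun_prop) (by fun_prop)
  simp only [Pi.mul_apply, ENNReal.rpow_two] at hH
  refine hH.trans ?_
  gcongr
  calc ∫⁻ z, (‖z.1‖ₑ + ‖z.2‖ₑ) ^ 2 ∂π
      ≤ ∫⁻ z, (2 * ‖z.1‖ₑ ^ 2 + 2 * ‖z.2‖ₑ ^ 2) ∂π := by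
        refine lintegral_mono fun z => ?_
        exact ENNReal.add_sq_le_two_mul _ _
    _ = 2 * ∫⁻ x, ‖x‖ₑ ^ 2 ∂μ + 2 * ∫⁻ x, ‖x‖ₑ ^ 2 ∂ν := by
        rw [lintegral_add_left (by fun_prop), lintegral_const_mul _ (by fun_prop),
          lintegral_const_mul _ (by fun_prop),
          ← lintegral_map (μ := π) (f := fun x : Rd d => ‖x‖ₑ ^ 2) (by fun_prop) measurable_fst,
          ← lintegral_map (μ := π) (f := fun x : Rd d => ‖x‖ₑ ^ 2) (by fun_prop) measurable_snd,
          h1, h2]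
    _ ≤ 2 * B + 2 * B := by gcongr
    _ = 4 * B := by ring

/-- The Fourier distance is controlled by the Wasserstein distance. -/
lemma fourierDist_le_mul_wassersteinDist {μ ν : Measure (Rd d)} [IsProbabilityMeasure μ]
    [IsProbabilityMeasure ν] {B : ℝ≥0∞} (hB0 : B ≠ 0) (hB : B < ∞)
    (hμ : ∫⁻ x, ‖x‖ₑ ^ 2 ∂μ ≤ B)
    (hν : ∫⁻ x, ‖x‖ₑ ^ 2 ∂ν ≤ B) (hμ0 : ∫ x, x ∂μ = 0) (hν0 : ∫ x, x ∂ν = 0) :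
    fourierDist μ ν ≤ (4 * B) ^ (1 / 2 : ℝ) * wassersteinDist μ ν := by
  -- A constant passes through the infimum over couplings only when it is neither zero nor infinite.
  have hc0 : (4 * B) ^ (1 / 2 : ℝ) ≠ 0 := by
    simp [ENNReal.rpow_eq_zero_iff, hB0]
  have hct : (4 * B) ^ (1 / 2 : ℝ) ≠ ∞ :=
    ENNReal.rpow_ne_top_of_nonneg (by norm_num) (ENNReal.mul_lt_top (by simp) hB).ne
  rw [wassersteinDist, ENNReal.mul_iInf_of_ne hc0 hct]
  refine le_iInf fun π => ?_
  rw [ENNReal.mul_iInf_of_ne hc0 hct]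
  refine le_iInf fun hπ => ?_
  refine iSup₂_le fun ξ _ => ?_
  refine ENNReal.div_le_of_le_mul ?_
  refine (fourierMeasure_sub_enorm_le_of_coupling hB hμ hν hμ0 hν0 hπ ξ).trans_eq ?_
  ring

end Moments

/-! ### The centered normalized measure. -/

section Centering

variable {d : ℕ}

lemma isProbabilityMeasure_centeredNormalized {m : ℝ} {μ : Measure (Rd d)}
    (h : IsPosMeasureWithMoment m μ) : IsProbabilityMeasure (centeredNormalized μ) := by
  constructor
  rw [centeredNormalized, Measure.smul_apply, Measure.map_apply (by fun_prop) MeasurableSet.univ,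
    Set.preimage_univ, smul_eq_mul, ENNReal.inv_mul_cancel h.mass_pos.ne' h.mass_lt_top.ne]

lemma lintegral_centeredNormalized (μ : Measure (Rd d)) {f : Rd d → ℝ≥0∞} (hf : Measurable f) :
    ∫⁻ x, f x ∂(centeredNormalized μ) = (μ Set.univ)⁻¹ * ∫⁻ x, f (x - barycenter μ) ∂μ := by
  rw [centeredNormalized, lintegral_smul_measure, lintegral_map hf (by fun_prop), smul_eq_mul]

lemma integral_id_centeredNormalized {ρ : ℝ} (hρ : 0 < ρ) {μ : Measure (Rd d)}
    (h : IsPosMeasureWithMoment (2 + ρ) μ) : ∫ x, x ∂(centeredNormalized μ) = 0 := by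
  have hfin : IsFiniteMeasure μ := ⟨h.mass_lt_top⟩
  have hint : Integrable (fun x => x) μ :=
    integrable_id_of_lintegral_enorm_sq_lt_top
      ((lintegral_enorm_sq_le_mass_add hρ μ).trans_lt
        (ENNReal.add_lt_top.2 ⟨h.mass_lt_top, h.moment_lt_top⟩))
  have hM : totalMass μ ≠ 0 := by
    rw [totalMass, Measure.real]
    exact (ENNReal.toReal_pos h.mass_pos.ne' h.mass_lt_top.ne).ne'
  rw [centeredNormalized, integral_smul_measure,
    integral_map (f := fun x : Rd d => x) (by fun_prop) (by fun_prop),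
    integral_sub hint (integrable_const _), integral_const, barycenter]
  change _ • (_ - totalMass μ • _) = _
  rw [smul_smul, mul_inv_cancel₀ hM, one_smul, sub_self, smul_zero]

end Centering

/-! ### Couplings through a common noisy variable. -/

section Coupling

variable {d : ℕ}

/-- A coupling of `μ` and `ν` obtained by coupling two noisy versions of them (with joint laws `P`
and `Q`, noisy variable first) along the common part `l` of the noisy laws, and independently on
the rest. -/
lemma exists_coupling_of_common_part {μ ν : Measure (Rd d)} [IsProbabilityMeasure μ]
    [IsProbabilityMeasure ν] {P Q : Measure (Rd d × Rd d)} [IsProbabilityMeasure P]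
    [IsProbabilityMeasure Q] (hP : P.snd = μ) (hQ : Q.snd = ν)
    {l α β : Measure (Rd d)} (hl : P.fst = l + α) (hl' : Q.fst = l + β) :
    ∃ π ∈ couplings μ ν, ∃ μ' ν' : Measure (Rd d), μ' ≤ μ ∧ ν' ≤ ν ∧
      μ' Set.univ = α Set.univ ∧ ν' Set.univ = β Set.univ ∧
      ∫⁻ z, ‖z.1 - z.2‖ₑ ^ 2 ∂π ≤
        2 * ∫⁻ z, ‖z.2 - z.1‖ₑ ^ 2 ∂P + 2 * ∫⁻ z, ‖z.2 - z.1‖ₑ ^ 2 ∂Q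
        + (2 * ∫⁻ x, ‖x‖ₑ ^ 2 ∂μ' + 2 * ∫⁻ x, ‖x‖ₑ ^ 2 ∂ν') := by
  -- `K` and `L` are the conditional laws of the original variable given its noisy version;
  -- averaging them over the noisy laws recovers `μ` and `ν`.
  set K := P.condKernel
  set L := Q.condKernel
  have hPK : P.fst ⊗ₘ K = P := P.disintegrate K
  have hQL : Q.fst ⊗ₘ L = Q := Q.disintegrate L
  have hlP : l ≤ P.fst := by rw [hl]; exact Measure.le_add_right le_rfl
  have hlQ : l ≤ Q.fst := by rw [hl']; exact Measure.le_add_right le_rfl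
  have hαP : α ≤ P.fst := by rw [hl]; exact Measure.le_add_left le_rfl
  have hβQ : β ≤ Q.fst := by rw [hl']; exact Measure.le_add_left le_rfl
  have : IsFiniteMeasure l := isFiniteMeasure_of_le _ hlP
  have : IsFiniteMeasure α := isFiniteMeasure_of_le _ hαP
  have : IsFiniteMeasure β := isFiniteMeasure_of_le _ hβQ
  have hμ : μ = K ∘ₘ l + K ∘ₘ α := by
    rw [← Measure.comp_add, ← hl, ← Measure.snd_compProd, hPK, hP]
  have hν : ν = L ∘ₘ l + L ∘ₘ β := by
    rw [← Measure.comp_add, ← hl', ← Measure.snd_compProd, hQL, hQ]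
  have hr : α Set.univ = β Set.univ := by
    have h1 : P.fst Set.univ = 1 := measure_univ
    have h2 : Q.fst Set.univ = 1 := measure_univ
    rw [hl, Measure.add_apply] at h1
    rw [hl', Measure.add_apply] at h2
    exact (ENNReal.add_right_inj (measure_ne_top l _)).1 (h1.trans h2.symm)
  have hKα : (K ∘ₘ α) Set.univ = α Set.univ := Measure.comp_apply_univ
  have hLβ : (L ∘ₘ β) Set.univ = β Set.univ := Measure.comp_apply_univ
  set r := α Set.univ with hrdef
  have hrt : r ≠ ∞ := measure_ne_top α _
  -- If `r = 0` the factor is `∞ * 0 = 0`, which is harmless because the measure then vanishes.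
  have hcancel : ∀ m : Measure (Rd d), m Set.univ = r → (r⁻¹ * r) • m = m := by
    intro m hm
    rcases eq_or_ne r 0 with h0 | h0
    · rw [h0] at hm
      rw [Measure.measure_univ_eq_zero.1 hm, smul_zero]
    · rw [ENNReal.inv_mul_cancel h0 hrt, one_smul]
  have hfst : ((K ×ₖ L) ∘ₘ l).map Prod.fst = K ∘ₘ l := by
    rw [Measure.map_comp _ _ measurable_fst, ← Kernel.fst_eq, Kernel.fst_prod]
  have hsnd : ((K ×ₖ L) ∘ₘ l).map Prod.snd = L ∘ₘ l := by
    rw [Measure.map_comp _ _ measurable_snd, ← Kernel.snd_eq, Kernel.snd_prod]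
  -- On the common part, draw a noisy point `w` from `l`, then the two originals independently from
  -- `K w` and `L w`. The leftovers have equal mass `r`, so their product divided by `r` has the
  -- right marginals.
  set π : Measure (Rd d × Rd d) := (K ×ₖ L) ∘ₘ l + r⁻¹ • (K ∘ₘ α).prod (L ∘ₘ β) with hπ
  have hπ1 : π.map Prod.fst = μ := by
    rw [hπ, Measure.map_add _ _ measurable_fst, Measure.map_smul, Measure.map_fst_prod, hfst, hLβ,
      ← hr, smul_smul, hcancel _ hKα, ← hμ]
  have hπ2 : π.map Prod.snd = ν := by
    rw [hπ, Measure.map_add _ _ measurable_snd, Measure.map_smul, Measure.map_snd_prod, hsnd, hKα,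
      smul_smul, hcancel _ (hLβ.trans hr.symm), ← hν]
  refine ⟨π, ⟨⟨?_⟩, hπ1, hπ2⟩, K ∘ₘ α, L ∘ₘ β, ?_, ?_, hKα, hLβ, ?_⟩
  · have h := congrArg (fun m : Measure (Rd d) => m Set.univ) hπ1
    simpa [Measure.map_apply measurable_fst MeasurableSet.univ] using h
  · rw [hμ]; exact Measure.le_add_left le_rfl
  · rw [hν]; exact Measure.le_add_left le_rfl
  rw [hπ, lintegral_add_measure]
  gcongr ?_ + ?_
  -- The cost of the common part is split by passing through the shared point `w`, leaving only the
  -- two noise displacements.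
  · rw [Measure.lintegral_bind (by fun_prop) (by fun_prop)]
    have hP2 : ∫⁻ z, ‖z.2 - z.1‖ₑ ^ 2 ∂P = ∫⁻ w, ∫⁻ x, ‖x - w‖ₑ ^ 2 ∂(K w) ∂P.fst := by
      conv_lhs => rw [← hPK]
      rw [Measure.lintegral_compProd (by fun_prop)]
    have hQ2 : ∫⁻ z, ‖z.2 - z.1‖ₑ ^ 2 ∂Q = ∫⁻ w, ∫⁻ x, ‖x - w‖ₑ ^ 2 ∂(L w) ∂Q.fst := by
      conv_lhs => rw [← hQL]
      rw [Measure.lintegral_compProd (by fun_prop)]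
    have hmK : Measurable fun w => ∫⁻ x, ‖x - w‖ₑ ^ 2 ∂(K w) :=
      Measurable.lintegral_kernel_prod_right' (f := fun p : Rd d × Rd d => ‖p.2 - p.1‖ₑ ^ 2)
        (by fun_prop)
    have hmL : Measurable fun w => ∫⁻ x, ‖x - w‖ₑ ^ 2 ∂(L w) :=
      Measurable.lintegral_kernel_prod_right' (f := fun p : Rd d × Rd d => ‖p.2 - p.1‖ₑ ^ 2)
        (by fun_prop)
    calc ∫⁻ w, ∫⁻ z, ‖z.1 - z.2‖ₑ ^ 2 ∂((K ×ₖ L) w) ∂l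
        ≤ ∫⁻ w, (2 * ∫⁻ x, ‖x - w‖ₑ ^ 2 ∂(K w) + 2 * ∫⁻ x, ‖x - w‖ₑ ^ 2 ∂(L w)) ∂l := by
          refine lintegral_mono fun w => ?_
          rw [Kernel.lintegral_prod _ _ _ (by fun_prop)]
          calc ∫⁻ x, ∫⁻ y, ‖x - y‖ₑ ^ 2 ∂(L w) ∂(K w)
              ≤ ∫⁻ x, ∫⁻ y, (2 * ‖x - w‖ₑ ^ 2 + 2 * ‖y - w‖ₑ ^ 2) ∂(L w) ∂(K w) := by
                refine lintegral_mono fun x => lintegral_mono fun y => ?_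
                have := enorm_sub_sq_le (x - w) (y - w)
                rwa [sub_sub_sub_cancel_right] at this
            _ = _ := by
                have hin : ∀ x, ∫⁻ y, (2 * ‖x - w‖ₑ ^ 2 + 2 * ‖y - w‖ₑ ^ 2) ∂(L w)
                    = 2 * ‖x - w‖ₑ ^ 2 + 2 * ∫⁻ y, ‖y - w‖ₑ ^ 2 ∂(L w) := fun x => by
                  rw [lintegral_add_left measurable_const, lintegral_const, measure_univ,
                    mul_one, lintegral_const_mul _ (by fun_prop)]
                simp_rw [hin]
                rw [lintegral_add_left (by fun_prop), lintegral_const, measure_univ, mul_one,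
                  lintegral_const_mul _ (by fun_prop)]
      _ = 2 * ∫⁻ w, ∫⁻ x, ‖x - w‖ₑ ^ 2 ∂(K w) ∂l + 2 * ∫⁻ w, ∫⁻ x, ‖x - w‖ₑ ^ 2 ∂(L w) ∂l := by
          rw [lintegral_add_left (hmK.const_mul _), lintegral_const_mul _ hmK,
            lintegral_const_mul _ hmL]
      _ ≤ _ := by
          rw [hP2, hQ2]
          gcongr
  · rw [lintegral_smul_measure, smul_eq_mul]
    calc r⁻¹ * ∫⁻ z, ‖z.1 - z.2‖ₑ ^ 2 ∂((K ∘ₘ α).prod (L ∘ₘ β))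
        ≤ r⁻¹ * ∫⁻ z, (2 * ‖z.1‖ₑ ^ 2 + 2 * ‖z.2‖ₑ ^ 2) ∂((K ∘ₘ α).prod (L ∘ₘ β)) := by
          gcongr with z
          exact enorm_sub_sq_le _ _
      _ = (r⁻¹ * r) * (2 * ∫⁻ x, ‖x‖ₑ ^ 2 ∂(K ∘ₘ α) + 2 * ∫⁻ x, ‖x‖ₑ ^ 2 ∂(L ∘ₘ β)) := by
          rw [lintegral_add_left (by fun_prop), lintegral_const_mul _ (by fun_prop),
            lintegral_const_mul _ (by fun_prop),
            ← lintegral_map (μ := (K ∘ₘ α).prod (L ∘ₘ β)) (f := fun x : Rd d => ‖x‖ₑ ^ 2)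
              (by fun_prop) measurable_fst,
            ← lintegral_map (μ := (K ∘ₘ α).prod (L ∘ₘ β)) (f := fun x : Rd d => ‖x‖ₑ ^ 2)
              (by fun_prop) measurable_snd, Measure.map_fst_prod, Measure.map_snd_prod,
            lintegral_smul_measure, lintegral_smul_measure, hKα, hLβ, ← hr, smul_eq_mul,
            smul_eq_mul]
          ring
      _ ≤ 1 * (2 * ∫⁻ x, ‖x‖ₑ ^ 2 ∂(K ∘ₘ α) + 2 * ∫⁻ x, ‖x‖ₑ ^ 2 ∂(L ∘ₘ β)) := by
          gcongr
          exact ENNReal.inv_mul_le_one r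
      _ = _ := one_mul _

/-- Split at radius `R`: inside the ball `‖x‖² ≤ R²`, outside it `‖x‖² ≤ R^{-ρ} ‖x‖^{2+ρ}`. A
submeasure of small mass thus has a small second moment once `R` is chosen suitably. -/
lemma lintegral_enorm_sq_le_of_le {ρ : ℝ} (hρ : 0 < ρ) {μ μ' : Measure (Rd d)} (h : μ' ≤ μ)
    {R : ℝ≥0∞} (hR : R ≠ 0) (hR' : R ≠ ∞) :
    ∫⁻ x, ‖x‖ₑ ^ 2 ∂μ' ≤ R ^ 2 * μ' Set.univ + R ^ (-ρ) * ∫⁻ x, ‖x‖ₑ ^ (2 + ρ) ∂μ := by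
  calc ∫⁻ x, ‖x‖ₑ ^ 2 ∂μ' ≤ ∫⁻ x, (R ^ 2 + R ^ (-ρ) * ‖x‖ₑ ^ (2 + ρ)) ∂μ' := by
        refine lintegral_mono fun x => ?_
        rcases le_total ‖x‖ₑ R with h1 | h1
        · exact (pow_le_pow_left₀ zero_le h1 2).trans le_self_add
        · refine le_trans ?_ le_add_self
          have hx : ‖x‖ₑ ≠ 0 := fun h0 => hR (le_antisymm (h1.trans h0.le) zero_le)
          rw [ENNReal.rpow_add _ _ hx enorm_ne_top, ENNReal.rpow_two, mul_left_comm]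
          refine le_mul_of_one_le_right zero_le ?_
          calc (1 : ℝ≥0∞) = R ^ (-ρ) * R ^ ρ := by
                rw [← ENNReal.rpow_add _ _ hR hR', neg_add_cancel, ENNReal.rpow_zero]
            _ ≤ R ^ (-ρ) * ‖x‖ₑ ^ ρ := by gcongr
    _ = R ^ 2 * μ' Set.univ + R ^ (-ρ) * ∫⁻ x, ‖x‖ₑ ^ (2 + ρ) ∂μ' := by
        rw [lintegral_add_left measurable_const, lintegral_const,
          lintegral_const_mul _ (by fun_prop)]
    _ ≤ _ := by gcongr

end Coupling

/-! ### Gaussian smoothing and the joint law of a variable and its noisy version. -/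

section GaussianSmoothing

variable {d : ℕ}

/-- The density of the centred Gaussian measure with covariance `2 s² • 1`. -/
noncomputable def heatKernel (d : ℕ) (s : ℝ) (u : Rd d) : ℝ :=
  (4 * Real.pi * s ^ 2) ^ (-(d / 2 : ℝ)) * Real.exp (-(1 / (4 * s ^ 2)) * ‖u‖ ^ 2)

lemma heatKernel_nonneg (s : ℝ) (u : Rd d) : 0 ≤ heatKernel d s u := by
  unfold heatKernel; positivity

@[fun_prop]
lemma continuous_heatKernel (s : ℝ) : Continuous (heatKernel d s) := by
  unfold heatKernel; fun_prop

lemma integrable_exp_neg_mul_sq_norm {b : ℝ} (hb : 0 < b) :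
    Integrable (fun v : Rd d => Real.exp (-b * ‖v‖ ^ 2)) := by
  have h := GaussianFourier.integrable_cexp_neg_mul_sq_norm_add (b := (b : ℂ)) (V := Rd d)
    (by simpa using hb) 0 0
  refine h.norm.congr (Filter.Eventually.of_forall fun v => ?_)
  simp only [zero_mul, add_zero]
  rw [Complex.norm_exp]
  congr 1
  rw [← Complex.ofReal_pow, ← Complex.ofReal_neg, ← Complex.ofReal_mul, Complex.ofReal_re]

lemma lintegral_exp_neg_mul_sq_norm {b : ℝ} (hb : 0 < b) :
    ∫⁻ v : Rd d, ENNReal.ofReal (Real.exp (-b * ‖v‖ ^ 2))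
      = ENNReal.ofReal ((Real.pi / b) ^ (d / 2 : ℝ)) := by
  rw [← ofReal_integral_eq_lintegral_ofReal (integrable_exp_neg_mul_sq_norm hb)
    (Filter.Eventually.of_forall fun v => (Real.exp_pos _).le),
    GaussianFourier.integral_rexp_neg_mul_sq_norm hb]
  simp

/-- Half of the Gaussian decay absorbs the quadratic factor. The resulting crude constant serves
both for the variance of the noise and for the frequency integral, where only the power of `s`
matters. -/
lemma sq_mul_exp_neg_le {b : ℝ} (hb : 0 < b) (y : ℝ) :
    y ^ 2 * Real.exp (-b * y ^ 2) ≤ 2 / b * Real.exp (-(b / 2) * y ^ 2) := by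
  have h1 : b / 2 * y ^ 2 ≤ Real.exp (b / 2 * y ^ 2) := by
    linarith [Real.add_one_le_exp (b / 2 * y ^ 2)]
  have h2 : y ^ 2 ≤ 2 / b * Real.exp (b / 2 * y ^ 2) := by
    rw [div_mul_eq_mul_div, le_div_iff₀ hb]; linarith
  calc y ^ 2 * Real.exp (-b * y ^ 2)
      ≤ 2 / b * Real.exp (b / 2 * y ^ 2) * Real.exp (-b * y ^ 2) := by gcongr
    _ = _ := by rw [mul_assoc, ← Real.exp_add]; ring_nf

lemma lintegral_sq_mul_exp_neg_mul_sq_norm_le {b : ℝ} (hb : 0 < b) :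
    ∫⁻ v : Rd d, ENNReal.ofReal (‖v‖ ^ 2 * Real.exp (-b * ‖v‖ ^ 2))
      ≤ ENNReal.ofReal (2 / b * (Real.pi / (b / 2)) ^ (d / 2 : ℝ)) := by
  calc ∫⁻ v : Rd d, ENNReal.ofReal (‖v‖ ^ 2 * Real.exp (-b * ‖v‖ ^ 2))
      ≤ ∫⁻ v : Rd d, ENNReal.ofReal (2 / b) * ENNReal.ofReal (Real.exp (-(b / 2) * ‖v‖ ^ 2)) := by
        refine lintegral_mono fun v => ?_
        rw [← ENNReal.ofReal_mul (by positivity)]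
        exact ENNReal.ofReal_le_ofReal (sq_mul_exp_neg_le hb _)
    _ = _ := by
        rw [lintegral_const_mul _ (by fun_prop), lintegral_exp_neg_mul_sq_norm (half_pos hb),
          ← ENNReal.ofReal_mul (by positivity)]

/-- The Gaussian measure with density `heatKernel d s`. -/
noncomputable def heatMeasure (d : ℕ) (s : ℝ) : Measure (Rd d) :=
  volume.withDensity fun u => ENNReal.ofReal (heatKernel d s u)

lemma isProbabilityMeasure_heatMeasure {s : ℝ} (hs : 0 < s) :
    IsProbabilityMeasure (heatMeasure d s) := by
  constructor
  rw [heatMeasure, withDensity_apply _ MeasurableSet.univ, Measure.restrict_univ]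
  unfold heatKernel
  simp_rw [ENNReal.ofReal_mul (show (0:ℝ) ≤ (4 * Real.pi * s ^ 2) ^ (-(d / 2 : ℝ)) by positivity)]
  rw [lintegral_const_mul _ (by fun_prop), lintegral_exp_neg_mul_sq_norm (by positivity),
    ← ENNReal.ofReal_mul (by positivity)]
  have : Real.pi / (1 / (4 * s ^ 2)) = 4 * Real.pi * s ^ 2 := by field_simp
  rw [this, ← Real.rpow_add (by positivity), neg_add_cancel, Real.rpow_zero, ENNReal.ofReal_one]

lemma lintegral_enorm_sq_heatMeasure_le {s : ℝ} (hs : 0 < s) :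
    ∫⁻ u, ‖u‖ₑ ^ 2 ∂(heatMeasure d s) ≤ ENNReal.ofReal (8 * 2 ^ (d / 2 : ℝ) * s ^ 2) := by
  have hc : (0:ℝ) ≤ (4 * Real.pi * s ^ 2) ^ (-(d / 2 : ℝ)) := by positivity
  rw [heatMeasure, lintegral_withDensity_eq_lintegral_mul _ (by fun_prop) (by fun_prop)]
  calc ∫⁻ u : Rd d, ((fun u : Rd d => ENNReal.ofReal (heatKernel d s u)) * fun u : Rd d => ‖u‖ₑ ^ 2) u
      = ∫⁻ u : Rd d, ENNReal.ofReal ((4 * Real.pi * s ^ 2) ^ (-(d / 2 : ℝ)))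
          * ENNReal.ofReal (‖u‖ ^ 2 * Real.exp (-(1 / (4 * s ^ 2)) * ‖u‖ ^ 2)) := by
        refine lintegral_congr fun u => ?_
        rw [Pi.mul_apply, ← ofReal_norm, ← ENNReal.ofReal_pow (norm_nonneg _),
          ← ENNReal.ofReal_mul (heatKernel_nonneg _ _), ← ENNReal.ofReal_mul hc, heatKernel]
        congr 1; ring
    _ ≤ ENNReal.ofReal ((4 * Real.pi * s ^ 2) ^ (-(d / 2 : ℝ))) * ENNReal.ofReal
          (2 / (1 / (4 * s ^ 2)) * (Real.pi / ((1 / (4 * s ^ 2)) / 2)) ^ (d / 2 : ℝ)) := by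
        rw [lintegral_const_mul _ (by fun_prop)]
        gcongr
        exact lintegral_sq_mul_exp_neg_mul_sq_norm_le (by positivity)
    _ = _ := by
        rw [← ENNReal.ofReal_mul hc]
        refine congrArg ENNReal.ofReal ?_
        have h1 : Real.pi / ((1 / (4 * s ^ 2)) / 2) = 2 * (4 * Real.pi * s ^ 2) := by
          field_simp
        have h2 : 2 / (1 / (4 * s ^ 2)) = 8 * s ^ 2 := by field_simp; norm_num
        have hX : (4 * Real.pi * s ^ 2) ^ (d / 2 : ℝ) ≠ 0 := by positivity
        rw [h1, h2, Real.mul_rpow zero_le_two (by positivity), Real.rpow_neg (by positivity)]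
        generalize (4 * Real.pi * s ^ 2) ^ (d / 2 : ℝ) = X at hX
        field_simp

/-- The density of the convolution of `μ` with the Gaussian measure `heatMeasure d s`. -/
noncomputable def smoothedDensity (μ : Measure (Rd d)) (s : ℝ) (w : Rd d) : ℝ≥0∞ :=
  ∫⁻ x, ENNReal.ofReal (heatKernel d s (w - x)) ∂μ

lemma measurable_smoothedDensity (μ : Measure (Rd d)) [SFinite μ] (s : ℝ) :
    Measurable (smoothedDensity μ s) := by
  unfold smoothedDensity
  exact Measurable.lintegral_prod_right'
    (f := fun p : Rd d × Rd d => ENNReal.ofReal (heatKernel d s (p.1 - p.2))) (by fun_prop)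

/-- The joint law of `(X + Z, X)`, with `X` of law `μ` and `Z` an independent Gaussian noise. -/
noncomputable def noisyLaw (μ : Measure (Rd d)) (s : ℝ) : Measure (Rd d × Rd d) :=
  (μ.prod (heatMeasure d s)).map fun p => (p.1 + p.2, p.1)

lemma isProbabilityMeasure_noisyLaw (μ : Measure (Rd d)) [IsProbabilityMeasure μ] {s : ℝ} (hs : 0 < s) :
    IsProbabilityMeasure (noisyLaw μ s) := by
  have := isProbabilityMeasure_heatMeasure (d := d) hs
  exact Measure.isProbabilityMeasure_map (by fun_prop)

lemma noisyLaw_snd (μ : Measure (Rd d)) [SFinite μ] {s : ℝ} (hs : 0 < s) :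
    (noisyLaw μ s).snd = μ := by
  have := isProbabilityMeasure_heatMeasure (d := d) hs
  rw [Measure.snd, noisyLaw, Measure.map_map measurable_snd (by fun_prop)]
  change Measure.map Prod.fst _ = _
  rw [Measure.map_fst_prod, measure_univ, one_smul]

lemma lintegral_noisyLaw (μ : Measure (Rd d)) [SFinite μ] {s : ℝ} (hs : 0 < s)
    {f : Rd d × Rd d → ℝ≥0∞} (hf : Measurable f) :
    ∫⁻ z, f z ∂(noisyLaw μ s) = ∫⁻ x, ∫⁻ u, f (x + u, x) ∂(heatMeasure d s) ∂μ := by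
  have := isProbabilityMeasure_heatMeasure (d := d) hs
  rw [noisyLaw, lintegral_map hf (by fun_prop), lintegral_prod _ (by fun_prop)]

lemma noisyLaw_fst (μ : Measure (Rd d)) [SFinite μ] {s : ℝ} (hs : 0 < s) :
    (noisyLaw μ s).fst = volume.withDensity (smoothedDensity μ s) := by
  refine Measure.ext_of_lintegral _ fun f hf => ?_
  rw [Measure.fst, lintegral_map hf measurable_fst,
    lintegral_noisyLaw μ hs (f := fun z => f z.1) (hf.comp measurable_fst),
    lintegral_withDensity_eq_lintegral_mul _ (measurable_smoothedDensity μ s) hf]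
  have h1 : ∀ x : Rd d, ∫⁻ u, f (x + u) ∂(heatMeasure d s)
      = ∫⁻ w, ENNReal.ofReal (heatKernel d s (w - x)) * f w := by
    intro x
    rw [heatMeasure, lintegral_withDensity_eq_lintegral_mul _ (by fun_prop) (by fun_prop),
      ← lintegral_sub_right_eq_self _ x]
    refine lintegral_congr fun w => ?_
    simp
  simp_rw [h1]
  rw [lintegral_lintegral_swap (by fun_prop)]
  refine lintegral_congr fun w => ?_
  rw [Pi.mul_apply, smoothedDensity, lintegral_mul_const _ (by fun_prop)]

lemma lintegral_noise_noisyLaw_le (μ : Measure (Rd d)) [IsProbabilityMeasure μ] {s : ℝ} (hs : 0 < s) :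
    ∫⁻ z, ‖z.2 - z.1‖ₑ ^ 2 ∂(noisyLaw μ s) ≤ ENNReal.ofReal (8 * 2 ^ (d / 2 : ℝ) * s ^ 2) := by
  rw [lintegral_noisyLaw μ hs (by fun_prop)]
  simp only [sub_add_cancel_left, enorm_neg, lintegral_const, measure_univ, mul_one]
  exact lintegral_enorm_sq_heatMeasure_le hs

lemma lintegral_enorm_sq_mul_smoothedDensity_le (μ : Measure (Rd d)) [IsProbabilityMeasure μ] {s : ℝ} (hs : 0 < s) :
    ∫⁻ w, ‖w‖ₑ ^ 2 * smoothedDensity μ s w ≤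
      2 * ∫⁻ x, ‖x‖ₑ ^ 2 ∂μ + 2 * ENNReal.ofReal (8 * 2 ^ (d / 2 : ℝ) * s ^ 2) := by
  have h : ∫⁻ w, ‖w‖ₑ ^ 2 * smoothedDensity μ s w = ∫⁻ z, ‖z.1‖ₑ ^ 2 ∂(noisyLaw μ s) := by
    rw [← lintegral_map (f := fun w : Rd d => ‖w‖ₑ ^ 2) (by fun_prop) measurable_fst]
    change _ = ∫⁻ w, ‖w‖ₑ ^ 2 ∂(noisyLaw μ s).fst
    rw [noisyLaw_fst μ hs,
      lintegral_withDensity_eq_lintegral_mul _ (measurable_smoothedDensity μ s) (by fun_prop)]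
    simp_rw [Pi.mul_apply, mul_comm]
  rw [h]
  calc ∫⁻ z, ‖z.1‖ₑ ^ 2 ∂(noisyLaw μ s)
      ≤ ∫⁻ z, (2 * ‖z.2‖ₑ ^ 2 + 2 * ‖z.2 - z.1‖ₑ ^ 2) ∂(noisyLaw μ s) := by
        refine lintegral_mono fun z => ?_
        have := enorm_sub_sq_le z.2 (z.2 - z.1)
        rwa [sub_sub_cancel] at this
    _ = 2 * ∫⁻ x, ‖x‖ₑ ^ 2 ∂(noisyLaw μ s).snd + 2 * ∫⁻ z, ‖z.2 - z.1‖ₑ ^ 2 ∂(noisyLaw μ s) := by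
        rw [lintegral_add_left (by fun_prop), lintegral_const_mul _ (by fun_prop),
          lintegral_const_mul _ (by fun_prop), Measure.snd,
          lintegral_map (f := fun w : Rd d => ‖w‖ₑ ^ 2) (by fun_prop) measurable_snd]
    _ ≤ _ := by
        rw [noisyLaw_snd μ hs]
        gcongr
        exact lintegral_noise_noisyLaw_le μ hs

/-- Fourier inversion for the heat kernel. -/
lemma heatKernel_eq_integral {s : ℝ} (hs : 0 < s) (u : Rd d) :
    (heatKernel d s u : ℂ) = (((4 * Real.pi ^ 2) ^ (-(d / 2 : ℝ)) : ℝ) : ℂ) *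
      ∫ ξ : Rd d, Complex.exp (-((s ^ 2 : ℝ) : ℂ) * ‖ξ‖ ^ 2 + Complex.I * (inner ℝ u ξ : ℝ)) := by
  have hs2 : 0 < s ^ 2 := by positivity
  rw [GaussianFourier.integral_cexp_neg_mul_sq_norm_add (by rwa [Complex.ofReal_re])]
  have h1 : ((Real.pi : ℂ) / ((s ^ 2 : ℝ) : ℂ)) ^ ((Module.finrank ℝ (Rd d) : ℂ) / 2)
      = (((Real.pi / s ^ 2) ^ (d / 2 : ℝ) : ℝ) : ℂ) := by
    rw [Complex.ofReal_cpow (by positivity)]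
    simp
  have h2 : Complex.exp (Complex.I ^ 2 * (‖u‖ : ℂ) ^ 2 / (4 * ((s ^ 2 : ℝ) : ℂ)))
      = ((Real.exp (-(1 / (4 * s ^ 2)) * ‖u‖ ^ 2) : ℝ) : ℂ) := by
    rw [Complex.ofReal_exp, Complex.I_sq]
    congr 1
    push_cast
    ring
  rw [h1, h2, ← mul_assoc, ← Complex.ofReal_mul, ← Complex.ofReal_mul, heatKernel]
  congr 2
  -- The normalizations agree because `(4π²)⁻¹ · π / s² = (4πs²)⁻¹`.
  rw [Real.rpow_neg (by positivity), Real.rpow_neg (by positivity), ← Real.inv_rpow (by positivity),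
    ← Real.inv_rpow (by positivity), ← Real.mul_rpow (by positivity) (by positivity)]
  congr 1
  field_simp

end GaussianSmoothing

/-! ### Comparing the smoothed densities by Fourier inversion. -/

section DensityComparison

variable {d : ℕ}

/-- Fourier inversion for the kernel, followed by Fubini: the Gaussian in `ξ` is integrable and the
oscillating factor has modulus one. -/
lemma integral_heatKernel_eq {s : ℝ} (hs : 0 < s) (μ : Measure (Rd d)) [IsProbabilityMeasure μ]
    (w : Rd d) :
    ((∫ x, heatKernel d s (w - x) ∂μ : ℝ) : ℂ) = (((4 * Real.pi ^ 2) ^ (-(d / 2 : ℝ)) : ℝ) : ℂ) *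
      ∫ ξ : Rd d, Complex.exp (-((s ^ 2 : ℝ) : ℂ) * ‖ξ‖ ^ 2 + Complex.I * (inner ℝ w ξ : ℝ))
        * fourierMeasure μ ξ := by
  have hs2 : 0 < s ^ 2 := by positivity
  set g : Rd d → ℂ := fun ξ =>
    Complex.exp (-((s ^ 2 : ℝ) : ℂ) * ‖ξ‖ ^ 2 + Complex.I * (inner ℝ w ξ : ℝ)) with hg
  have hgi : Integrable g := GaussianFourier.integrable_cexp_neg_mul_sq_norm_add
    (by rwa [Complex.ofReal_re]) Complex.I w
  have hint : Integrable (Function.uncurry fun x ξ : Rd d =>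
      g ξ * Complex.exp (-(Complex.I * ((inner ℝ x ξ : ℝ) : ℂ)))) (μ.prod volume) := by
    have h1 : Integrable (fun p : Rd d × Rd d => g p.2) (μ.prod volume) := hgi.comp_snd μ
    refine h1.mono (Continuous.aestronglyMeasurable (by
      simp only [hg, Function.uncurry_def]; fun_prop)) (Filter.Eventually.of_forall fun p => ?_)
    simp only [Function.uncurry_def, norm_mul, norm_exp_neg_I_mul_inner, mul_one, le_refl]
  rw [← integral_complex_ofReal]
  have hpt : ∀ x, ((heatKernel d s (w - x) : ℝ) : ℂ) =
      (((4 * Real.pi ^ 2) ^ (-(d / 2 : ℝ)) : ℝ) : ℂ) *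
        ∫ ξ : Rd d, g ξ * Complex.exp (-(Complex.I * ((inner ℝ x ξ : ℝ) : ℂ))) := by
    intro x
    rw [heatKernel_eq_integral hs]
    congr 1
    refine integral_congr_ae (Filter.Eventually.of_forall fun ξ => ?_)
    simp only [hg]
    rw [← Complex.exp_add, inner_sub_left]
    congr 1
    push_cast
    ring
  simp_rw [hpt]
  rw [integral_const_mul, integral_integral_swap hint]
  congr 1
  refine integral_congr_ae (Filter.Eventually.of_forall fun ξ => ?_)
  simp only [fourierMeasure]
  rw [integral_const_mul]

lemma norm_fourierMeasure_le_one (μ : Measure (Rd d)) [IsProbabilityMeasure μ] (ξ : Rd d) :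
    ‖fourierMeasure μ ξ‖ ≤ 1 := by
  exact (norm_integral_le_of_norm_le_const (C := 1) (Filter.Eventually.of_forall fun x =>
    (norm_exp_neg_I_mul_inner x ξ).le)).trans (by simp)

lemma continuous_fourierMeasure (μ : Measure (Rd d)) [IsProbabilityMeasure μ] :
    Continuous (fourierMeasure μ) := by
  refine continuous_of_dominated (bound := fun _ => 1) (fun ξ => ?_) (fun ξ => ?_)
    (integrable_const _) (Filter.Eventually.of_forall fun x => by fun_prop)
  · exact Continuous.aestronglyMeasurable (by fun_prop)
  · exact Filter.Eventually.of_forall fun x => (norm_exp_neg_I_mul_inner x ξ).le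

lemma enorm_fourierMeasure_sub_le (μ ν : Measure (Rd d)) [IsProbabilityMeasure μ]
    [IsProbabilityMeasure ν] (ξ : Rd d) :
    ‖fourierMeasure μ ξ - fourierMeasure ν ξ‖ₑ ≤ fourierDist μ ν * ‖ξ‖ₑ ^ 2 := by
  rcases eq_or_ne ξ 0 with rfl | h
  · simp [fourierMeasure]
  · have h1 : ‖fourierMeasure μ ξ - fourierMeasure ν ξ‖ₑ / ‖ξ‖ₑ ^ 2 ≤ fourierDist μ ν :=
      le_iSup₂_of_le ξ h le_rfl
    rwa [ENNReal.div_le_iff (by simpa using h) (by simp)] at h1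

lemma integrable_heatKernel_sub {s : ℝ} (μ : Measure (Rd d)) [IsProbabilityMeasure μ]
    (w : Rd d) : Integrable (fun x => heatKernel d s (w - x)) μ := by
  refine Integrable.of_bound (C := (4 * Real.pi * s ^ 2) ^ (-(d / 2 : ℝ)))
    (Continuous.aestronglyMeasurable (by fun_prop)) (Filter.Eventually.of_forall fun x => ?_)
  rw [Real.norm_of_nonneg (heatKernel_nonneg _ _), heatKernel]
  refine mul_le_of_le_one_right (by positivity) (Real.exp_le_one_iff.2 ?_)
  have : 0 ≤ 1 / (4 * s ^ 2) * ‖w - x‖ ^ 2 := by positivity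
  linarith

lemma smoothedDensity_eq_ofReal {s : ℝ} (μ : Measure (Rd d)) [IsProbabilityMeasure μ]
    (w : Rd d) :
    smoothedDensity μ s w = ENNReal.ofReal (∫ x, heatKernel d s (w - x) ∂μ) := by
  rw [smoothedDensity, ofReal_integral_eq_lintegral_ofReal (integrable_heatKernel_sub μ w)
    (Filter.Eventually.of_forall fun x => heatKernel_nonneg _ _)]

/-- By inversion the difference is at most a constant times `d₂ ∫ |ξ|² e^{-s²|ξ|²} dξ`, and the
integral scales like `s^{-(d+2)}`. Truncated subtraction keeps just the excess of one density over
the other. -/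
lemma exists_smoothedDensity_tsub_le (d : ℕ) : ∃ K : ℝ, 0 < K ∧
    ∀ (μ ν : Measure (Rd d)) [IsProbabilityMeasure μ] [IsProbabilityMeasure ν] (s : ℝ) (_ : 0 < s)
      (w : Rd d), smoothedDensity μ s w - smoothedDensity ν s w
        ≤ ENNReal.ofReal (K / s ^ (d + 2)) * fourierDist μ ν := by
  refine ⟨2 * ((4 * Real.pi ^ 2) ^ (-(d / 2 : ℝ)) * (2 * Real.pi) ^ (d / 2 : ℝ)), by positivity, ?_⟩
  intro μ ν _ _ s hs w
  have hs2 : 0 < s ^ 2 := by positivity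
  set c : ℝ := (4 * Real.pi ^ 2) ^ (-(d / 2 : ℝ)) with hc
  have hc0 : 0 ≤ c := by positivity
  set g : Rd d → ℂ := fun ξ =>
    Complex.exp (-((s ^ 2 : ℝ) : ℂ) * ‖ξ‖ ^ 2 + Complex.I * (inner ℝ w ξ : ℝ)) with hg
  have hgn : ∀ ξ, ‖g ξ‖ = Real.exp (-(s ^ 2) * ‖ξ‖ ^ 2) := by
    intro ξ
    rw [hg]
    simp only
    rw [Complex.norm_exp]
    congr 1
    rw [← Complex.ofReal_pow, ← Complex.ofReal_neg, ← Complex.ofReal_mul, Complex.add_re,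
      Complex.ofReal_re]
    simp
  have hgi : Integrable g := GaussianFourier.integrable_cexp_neg_mul_sq_norm_add
    (by rwa [Complex.ofReal_re]) Complex.I w
  have hgf : ∀ (m : Measure (Rd d)) [IsProbabilityMeasure m],
      Integrable (fun ξ => g ξ * fourierMeasure m ξ) := by
    intro m _
    exact hgi.mul_bdd (c := 1) (continuous_fourierMeasure m).aestronglyMeasurable
      (Filter.Eventually.of_forall fun ξ => norm_fourierMeasure_le_one m ξ)
  set a := ∫ x, heatKernel d s (w - x) ∂μ
  set b := ∫ x, heatKernel d s (w - x) ∂ν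
  have hb : 0 ≤ b := integral_nonneg fun x => heatKernel_nonneg _ _
  have hab : ((a - b : ℝ) : ℂ) = (c : ℂ) *
      ∫ ξ, g ξ * (fourierMeasure μ ξ - fourierMeasure ν ξ) := by
    rw [Complex.ofReal_sub, integral_heatKernel_eq hs μ w, integral_heatKernel_eq hs ν w, ← mul_sub,
      ← integral_sub (hgf μ) (hgf ν)]
    simp_rw [mul_sub]
    rfl
  rw [smoothedDensity_eq_ofReal, smoothedDensity_eq_ofReal, ← ENNReal.ofReal_sub _ hb]
  calc ENNReal.ofReal (a - b) ≤ ‖((a - b : ℝ) : ℂ)‖ₑ := by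
        rw [← ofReal_norm, Complex.norm_real]
        exact ENNReal.ofReal_le_ofReal (le_abs_self _)
    _ ≤ ENNReal.ofReal c * ∫⁻ ξ, ‖g ξ * (fourierMeasure μ ξ - fourierMeasure ν ξ)‖ₑ := by
        rw [hab, enorm_mul]
        gcongr
        · rw [← ofReal_norm, Complex.norm_real, Real.norm_of_nonneg hc0]
        · exact enorm_integral_le_lintegral_enorm _
    _ ≤ ENNReal.ofReal c * ∫⁻ ξ : Rd d, fourierDist μ ν *
          ENNReal.ofReal (‖ξ‖ ^ 2 * Real.exp (-(s ^ 2) * ‖ξ‖ ^ 2)) := by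
        gcongr with ξ
        rw [enorm_mul, ← ofReal_norm (g ξ), hgn, ENNReal.ofReal_mul (by positivity),
          ENNReal.ofReal_pow (norm_nonneg _), ofReal_norm, ← mul_assoc, mul_comm]
        gcongr
        exact enorm_fourierMeasure_sub_le μ ν ξ
    _ ≤ ENNReal.ofReal c * (fourierDist μ ν *
          ENNReal.ofReal (2 / s ^ 2 * (Real.pi / (s ^ 2 / 2)) ^ (d / 2 : ℝ))) := by
        rw [lintegral_const_mul _ (by fun_prop)]
        gcongr
        exact lintegral_sq_mul_exp_neg_mul_sq_norm_le hs2
    _ = _ := by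
        rw [mul_left_comm, mul_comm, ← ENNReal.ofReal_mul hc0]
        congr 2
        have h1 : Real.pi / (s ^ 2 / 2) = (2 * Real.pi) / s ^ 2 := by field_simp
        have h2 : (s ^ 2) ^ (d / 2 : ℝ) = s ^ d := by
          rw [← Real.rpow_natCast s 2, ← Real.rpow_mul hs.le, ← Real.rpow_natCast s d]
          congr 1
          push_cast
          ring
        rw [h1, Real.div_rpow (by positivity) (by positivity), h2]
        generalize (2 * Real.pi) ^ (d / 2 : ℝ) = X
        field_simp
        ring

/-- The common part of two noisy laws misses only a small mass when the Fourier distance is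
small. -/
lemma exists_lintegral_smoothedDensity_tsub_le (d : ℕ) {B : ℝ} (hB : 0 < B) : ∃ K : ℝ, 0 < K ∧
    ∀ (μ ν : Measure (Rd d)) [IsProbabilityMeasure μ] [IsProbabilityMeasure ν],
      ∫⁻ x, ‖x‖ₑ ^ 2 ∂μ ≤ ENNReal.ofReal B → ∀ s : ℝ, 0 < s → s ≤ 1 →
      fourierDist μ ν ≤ ENNReal.ofReal (s ^ (2 * d + 4)) →
      ∫⁻ w, (smoothedDensity μ s w - smoothedDensity ν s w) ≤ ENNReal.ofReal (K * s ^ 2) := by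
  obtain ⟨K, hK, hmain⟩ := exists_smoothedDensity_tsub_le d
  set V : ℝ := volume.real (Metric.ball (0 : Rd d) 1) with hV
  have hV0 : 0 ≤ V := measureReal_nonneg
  set G : ℝ := 8 * 2 ^ (d / 2 : ℝ) with hG
  have hG0 : 0 < G := by positivity
  refine ⟨V * K + (2 * B + 2 * G), by positivity, ?_⟩
  intro μ ν _ _ hμ s hs hs1 hD
  have hball : volume (Metric.ball (0 : Rd d) (1 / s)) = ENNReal.ofReal ((1 / s) ^ d * V) := by
    rw [Measure.addHaar_ball_of_pos _ _ (by positivity), ENNReal.ofReal_mul (by positivity), hV,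
      measureReal_def, ENNReal.ofReal_toReal measure_ball_lt_top.ne]
    simp
  rw [← lintegral_add_compl _ (measurableSet_ball (x := (0 : Rd d)) (ε := 1 / s))]
  -- The exponent `2d + 4` is set here: volume `s^{-d}` times the density bound `s^{-(d+2)}
  -- s^{2d+4}` leaves `s²`.
  have hin : ∫⁻ w in Metric.ball (0 : Rd d) (1 / s),
      (smoothedDensity μ s w - smoothedDensity ν s w) ≤ ENNReal.ofReal (V * K * s ^ 2) := by
    calc _ ≤ ∫⁻ _ in Metric.ball (0 : Rd d) (1 / s),
          ENNReal.ofReal (K / s ^ (d + 2)) * ENNReal.ofReal (s ^ (2 * d + 4)) := by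
          refine lintegral_mono fun w => (hmain μ ν s hs w).trans ?_
          gcongr
      _ = ENNReal.ofReal (V * K * s ^ 2) := by
          rw [setLIntegral_const, hball, ← ENNReal.ofReal_mul (by positivity),
            ← ENNReal.ofReal_mul (by positivity)]
          congr 1
          have : s ^ (2 * d + 4) = s ^ d * s ^ (d + 2) * s ^ 2 := by ring
          rw [this, one_div, inv_pow]
          field_simp
  -- Outside the ball `s² ‖w‖² ≥ 1`, so Chebyshev's inequality applies.
  have hout : ∫⁻ w in (Metric.ball (0 : Rd d) (1 / s))ᶜ,
      (smoothedDensity μ s w - smoothedDensity ν s w)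
        ≤ ENNReal.ofReal ((2 * B + 2 * G) * s ^ 2) := by
    calc _ ≤ ∫⁻ w in (Metric.ball (0 : Rd d) (1 / s))ᶜ,
          ENNReal.ofReal (s ^ 2) * (‖w‖ₑ ^ 2 * smoothedDensity μ s w) := by
          refine setLIntegral_mono' measurableSet_ball.compl fun w hw => tsub_le_self.trans ?_
          rw [← mul_assoc]
          refine le_mul_of_one_le_left zero_le ?_
          have hw' : 1 / s ≤ ‖w‖ := by simpa using hw
          rw [← ofReal_norm, ← ENNReal.ofReal_pow (norm_nonneg _),
            ← ENNReal.ofReal_mul (by positivity), ← mul_pow]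
          rw [div_le_iff₀ hs] at hw'
          rw [ENNReal.one_le_ofReal]
          exact one_le_pow₀ (by linarith)
      _ ≤ ENNReal.ofReal (s ^ 2) * ∫⁻ w, ‖w‖ₑ ^ 2 * smoothedDensity μ s w := by
          have := measurable_smoothedDensity μ s
          rw [← lintegral_const_mul _ (by fun_prop)]
          exact setLIntegral_le_lintegral _ _
      _ ≤ ENNReal.ofReal (s ^ 2) * (2 * ENNReal.ofReal B + 2 * ENNReal.ofReal (G * 1)) := by
          gcongr
          refine (lintegral_enorm_sq_mul_smoothedDensity_le μ hs).trans ?_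
          gcongr
          exact pow_le_one₀ hs.le hs1
      _ = _ := by
          have h2 : (2 : ℝ≥0∞) = ENNReal.ofReal 2 := by simp
          rw [h2, ← ENNReal.ofReal_mul (by positivity), ← ENNReal.ofReal_mul (by positivity),
            ← ENNReal.ofReal_add (by positivity) (by positivity),
            ← ENNReal.ofReal_mul (by positivity)]
          congr 1; ring
  refine (add_le_add hin hout).trans_eq ?_
  rw [← ENNReal.ofReal_add (by positivity) (by positivity)]
  congr 1; ring

end DensityComparison

/-! ### Bounding `W₂` by a power of `d₂`. -/

section WassersteinBound

variable {d : ℕ}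

lemma exists_wassersteinDist_le_of_fourierDist_le (d : ℕ) {ρ M : ℝ} (hρ : 0 < ρ) (hM : 0 < M) :
    ∃ K : ℝ, 0 < K ∧ ∀ (μ ν : Measure (Rd d)) [IsProbabilityMeasure μ] [IsProbabilityMeasure ν],
      ∫⁻ x, ‖x‖ₑ ^ (2 + ρ) ∂μ ≤ ENNReal.ofReal M → ∫⁻ x, ‖x‖ₑ ^ (2 + ρ) ∂ν ≤ ENNReal.ofReal M →
      ∀ s : ℝ, 0 < s → s ≤ 1 → fourierDist μ ν ≤ ENNReal.ofReal (s ^ (2 * d + 4)) →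
      wassersteinDist μ ν ≤ ENNReal.ofReal (K * s ^ (min 1 (ρ / 2) / 2)) := by
  obtain ⟨T, hT, htail⟩ := exists_lintegral_smoothedDensity_tsub_le d (B := 1 + M) (by positivity)
  set G : ℝ := 8 * 2 ^ (d / 2 : ℝ) with hG
  have hG0 : 0 < G := by positivity
  set γ : ℝ := min 1 (ρ / 2) with hγ
  have hγ1 : γ ≤ 1 := min_le_left _ _
  have hγ2 : γ ≤ ρ / 2 := min_le_right _ _
  -- `4 * G` pays for the noise of both measures, `4 * (T + M)` for their unmatched parts.
  refine ⟨(4 * G + 4 * (T + M)) ^ (1 / 2 : ℝ), by positivity, ?_⟩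
  intro μ ν _ _ hμ hν s hs hs1 hD
  have hD' : fourierDist ν μ ≤ ENNReal.ofReal (s ^ (2 * d + 4)) := by
    refine le_of_eq_of_le ?_ hD
    unfold fourierDist
    simp_rw [← enorm_neg (fourierMeasure ν _ - fourierMeasure μ _), neg_sub]
  have h1M : ENNReal.ofReal (1 + M) = 1 + ENNReal.ofReal M := by
    rw [ENNReal.ofReal_add zero_le_one hM.le, ENNReal.ofReal_one]
  have tμ := htail μ ν (h1M ▸ lintegral_enorm_sq_le_one_add hρ hμ) s hs hs1 hD
  have tν := htail ν μ (h1M ▸ lintegral_enorm_sq_le_one_add hρ hν) s hs hs1 hD'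
  have mμ := measurable_smoothedDensity μ s
  have mν := measurable_smoothedDensity ν s
  have := isProbabilityMeasure_noisyLaw μ hs
  have := isProbabilityMeasure_noisyLaw ν hs
  -- The minimum of the two densities is the common part; the leftovers are the truncated
  -- differences.
  set l : Measure (Rd d) :=
    volume.withDensity fun w => min (smoothedDensity μ s w) (smoothedDensity ν s w)
  have hl : (noisyLaw μ s).fst = l + volume.withDensity
      fun w => smoothedDensity μ s w - smoothedDensity ν s w := by
    rw [noisyLaw_fst μ hs, ← withDensity_add_left (by fun_prop)]
    congr 1
    ext w
    rw [Pi.add_apply, add_comm, tsub_add_min]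
  have hl' : (noisyLaw ν s).fst = l + volume.withDensity
      fun w => smoothedDensity ν s w - smoothedDensity μ s w := by
    rw [noisyLaw_fst ν hs, ← withDensity_add_left (by fun_prop)]
    congr 1
    ext w
    rw [Pi.add_apply, add_comm, min_comm, tsub_add_min]
  obtain ⟨π, hπ, μ', ν', hμ', hν', eμ, eν, hcost⟩ := exists_coupling_of_common_part
    (noisyLaw_snd μ hs) (noisyLaw_snd ν hs) hl hl'
  rw [withDensity_apply _ MeasurableSet.univ, Measure.restrict_univ] at eμ eν
  -- Truncation radius `R = s^{-1/2}`: the unmatched mass `T s²` contributes `R² T s² = T s`, and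
  -- the tail contributes `R^{-ρ} M = M s^{ρ/2}`.
  have hR0 : ENNReal.ofReal (s ^ (-(1 / 2) : ℝ)) ≠ 0 := by
    rw [ne_eq, ENNReal.ofReal_eq_zero, not_le]; positivity
  have hR2 : ENNReal.ofReal (s ^ (-(1 / 2) : ℝ)) ^ 2 = ENNReal.ofReal (s⁻¹) := by
    rw [← ENNReal.ofReal_pow (by positivity), ← Real.rpow_natCast, ← Real.rpow_mul hs.le]
    norm_num [Real.rpow_neg_one]
  have hRρ : ENNReal.ofReal (s ^ (-(1 / 2) : ℝ)) ^ (-ρ) = ENNReal.ofReal (s ^ (ρ / 2)) := by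
    rw [ENNReal.ofReal_rpow_of_pos (by positivity), ← Real.rpow_mul hs.le]
    congr 2; ring
  have hsγ : s ≤ s ^ γ := by
    simpa using Real.rpow_le_rpow_of_exponent_ge hs hs1 hγ1
  have hsρ : s ^ (ρ / 2) ≤ s ^ γ := Real.rpow_le_rpow_of_exponent_ge hs hs1 hγ2
  have hres : ∀ m m' : Measure (Rd d), m' ≤ m → m' Set.univ ≤ ENNReal.ofReal (T * s ^ 2) →
      ∫⁻ x, ‖x‖ₑ ^ (2 + ρ) ∂m ≤ ENNReal.ofReal M →
      ∫⁻ x, ‖x‖ₑ ^ 2 ∂m' ≤ ENNReal.ofReal ((T + M) * s ^ γ) := by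
    intro m m' hle hmass hmom
    refine (lintegral_enorm_sq_le_of_le hρ hle hR0 ENNReal.ofReal_ne_top).trans ?_
    rw [hR2, hRρ]
    calc _ ≤ ENNReal.ofReal s⁻¹ * ENNReal.ofReal (T * s ^ 2)
          + ENNReal.ofReal (s ^ (ρ / 2)) * ENNReal.ofReal M := by gcongr
      _ = ENNReal.ofReal (T * s + M * s ^ (ρ / 2)) := by
          rw [← ENNReal.ofReal_mul (by positivity), ← ENNReal.ofReal_mul (by positivity),
            ← ENNReal.ofReal_add (by positivity) (by positivity)]
          congr 1
          field_simp
      _ ≤ _ := by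
          apply ENNReal.ofReal_le_ofReal
          rw [add_mul]
          gcongr
  have hfinal : ∫⁻ z, ‖z.1 - z.2‖ₑ ^ 2 ∂π ≤ ENNReal.ofReal ((4 * G + 4 * (T + M)) * s ^ γ) := by
    refine hcost.trans ?_
    calc _ ≤ 2 * ENNReal.ofReal (G * s ^ 2) + 2 * ENNReal.ofReal (G * s ^ 2)
          + (2 * ENNReal.ofReal ((T + M) * s ^ γ) + 2 * ENNReal.ofReal ((T + M) * s ^ γ)) := by
          gcongr
          · exact lintegral_noise_noisyLaw_le μ hs
          · exact lintegral_noise_noisyLaw_le ν hs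
          · exact hres μ μ' hμ' (eμ.le.trans tμ) hμ
          · exact hres ν ν' hν' (eν.le.trans tν) hν
      _ = ENNReal.ofReal (4 * (G * s ^ 2) + 4 * ((T + M) * s ^ γ)) := by
          rw [ENNReal.ofReal_add (by positivity) (by positivity),
            ENNReal.ofReal_mul (p := 4) (q := G * s ^ 2) (by norm_num),
            ENNReal.ofReal_mul (p := 4) (q := (T + M) * s ^ γ) (by norm_num), ENNReal.ofReal_ofNat]
          generalize ENNReal.ofReal (G * s ^ 2) = x
          generalize ENNReal.ofReal ((T + M) * s ^ γ) = y
          ring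
      _ ≤ _ := by
          apply ENNReal.ofReal_le_ofReal
          have : s ^ 2 ≤ s ^ γ := (by nlinarith : s ^ 2 ≤ s).trans hsγ
          have := mul_le_mul_of_nonneg_left this hG0.le
          linarith
  refine (iInf₂_le π hπ).trans ?_
  calc _ ≤ ENNReal.ofReal ((4 * G + 4 * (T + M)) * s ^ γ) ^ (1 / 2 : ℝ) := by gcongr
    _ = _ := by
        rw [ENNReal.ofReal_rpow_of_nonneg (by positivity) (by norm_num),
          Real.mul_rpow (by positivity) (by positivity), ← Real.rpow_mul hs.le]
        congr 3
        ring

/-- The Wasserstein distance is controlled by a power of the Fourier distance, plus the Fourier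
distance itself. -/
lemma exists_wassersteinDist_le_fourierDist_rpow (d : ℕ) {ρ M : ℝ} (hρ : 0 < ρ) (hM : 0 < M) :
    ∃ K q : ℝ, 0 < K ∧ 0 < q ∧ q < 1 ∧
      ∀ (μ ν : Measure (Rd d)) [IsProbabilityMeasure μ] [IsProbabilityMeasure ν],
      ∫⁻ x, ‖x‖ₑ ^ (2 + ρ) ∂μ ≤ ENNReal.ofReal M → ∫⁻ x, ‖x‖ₑ ^ (2 + ρ) ∂ν ≤ ENNReal.ofReal M →
      wassersteinDist μ ν ≤ ENNReal.ofReal K * (fourierDist μ ν ^ q + fourierDist μ ν) := by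
  obtain ⟨K, hK, hmain⟩ := exists_wassersteinDist_le_of_fourierDist_le d hρ hM
  set γ : ℝ := min 1 (ρ / 2) / 2 with hγ
  have hγ0 : 0 < γ := by positivity
  have hγ1 : γ ≤ 1 / 2 := by
    have : min 1 (ρ / 2) ≤ 1 := min_le_left _ _
    rw [hγ]; linarith
  set A : ℝ := (4 * (1 + M)) ^ (1 / 2 : ℝ) with hA
  have hA0 : 0 < A := by positivity
  have hn : (1 : ℝ) < ((2 * d + 4 : ℕ) : ℝ) := by norm_cast; omega
  -- `K` serves the range `D ≤ 1`, with `s = D^{1/(2d+4)}`, and `A` the range `D ≥ 1`.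
  refine ⟨K + A, γ / ((2 * d + 4 : ℕ) : ℝ), by positivity, by positivity, ?_, ?_⟩
  · rw [div_lt_one (by linarith)]; linarith
  intro μ ν _ _ hμ hν
  set D := fourierDist μ ν with hD
  rcases eq_or_ne D 0 with h0 | h0
  -- For `D = 0` every `s` in `(0, 1]` is admissible, so let `s` tend to zero.
  · have hlim : Filter.Tendsto (fun s : ℝ => ENNReal.ofReal (K * s ^ γ)) (nhdsWithin 0 (Set.Ioi 0))
        (nhds 0) := by
      have h1 : Continuous fun s : ℝ => ENNReal.ofReal (K * s ^ γ) :=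
        ENNReal.continuous_ofReal.comp
          (continuous_const.mul (Real.continuous_rpow_const hγ0.le))
      have h2 := h1.tendsto 0
      rw [Real.zero_rpow hγ0.ne', mul_zero, ENNReal.ofReal_zero] at h2
      exact h2.mono_left nhdsWithin_le_nhds
    refine (ge_of_tendsto hlim ?_).trans zero_le
    filter_upwards [Ioc_mem_nhdsGT (zero_lt_one (α := ℝ))] with s hs
    exact hmain μ ν hμ hν s hs.1 hs.2 (by rw [← hD, h0]; exact zero_le)
  rcases le_total D 1 with h1 | h1
  · have hDt : D ≠ ∞ := (h1.trans_lt ENNReal.one_lt_top).ne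
    have hr : 0 < D.toReal := ENNReal.toReal_pos h0 hDt
    have hr1 : D.toReal ≤ 1 := by simpa using ENNReal.toReal_mono ENNReal.one_ne_top h1
    have h := hmain μ ν hμ hν (D.toReal ^ (((2 * d + 4 : ℕ) : ℝ)⁻¹)) (by positivity)
      (Real.rpow_le_one hr.le hr1 (by positivity)) (by
        rw [Real.rpow_inv_natCast_pow hr.le (by omega), ENNReal.ofReal_toReal hDt])
    rw [← Real.rpow_mul hr.le, inv_mul_eq_div, ENNReal.ofReal_mul hK.le,
      ← ENNReal.ofReal_rpow_of_pos hr, ENNReal.ofReal_toReal hDt] at h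
    refine h.trans ?_
    gcongr
    · linarith
    · exact le_self_add
  -- For `D ≥ 1` the product coupling bounds `W₂` by `A ≤ A * D`; this produces the linear term.
  · have h := wassersteinDist_le_of_moments (lintegral_enorm_sq_le_one_add hρ hμ)
      (lintegral_enorm_sq_le_one_add hρ hν)
    have hA' : (4 * (1 + ENNReal.ofReal M)) ^ (1 / 2 : ℝ) = ENNReal.ofReal A := by
      rw [hA, ← ENNReal.ofReal_rpow_of_nonneg (by positivity) (by norm_num),
        ENNReal.ofReal_mul (by norm_num), ENNReal.ofReal_add zero_le_one hM.le]
      norm_num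
    rw [hA'] at h
    calc _ ≤ ENNReal.ofReal A * 1 := by rwa [mul_one]
      _ ≤ _ := by
        gcongr
        · linarith
        · exact h1.trans le_add_self

end WassersteinBound

/-! ### The generalized distances. -/

theorem mainTheorem6 (d : ℕ) (hd : 1 ≤ d) (ρ M : ℝ) (hρ : 0 < ρ) (hM : 0 < M) :
    ∃ c C q : ℝ, 0 < c ∧ 0 < C ∧ 0 < q ∧ q < 1 ∧
      ∀ μ ν : Measure (Rd d),
        IsPosMeasureWithMoment (2 + ρ) μ →
        IsPosMeasureWithMoment (2 + ρ) ν →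
        (μ Set.univ)⁻¹ * ∫⁻ x, ‖x - barycenter μ‖ₑ ^ (2 + ρ) ∂μ ≤ ENNReal.ofReal M →
        (ν Set.univ)⁻¹ * ∫⁻ x, ‖x - barycenter ν‖ₑ ^ (2 + ρ) ∂ν ≤ ENNReal.ofReal M →
        genFourierDist μ ν < ∞ ∧ genWassersteinDist μ ν < ∞ ∧
        ENNReal.ofReal c * genFourierDist μ ν ≤ genWassersteinDist μ ν ∧
        genWassersteinDist μ ν ≤
          ENNReal.ofReal C * (genFourierDist μ ν ^ q + genFourierDist μ ν) := by
  obtain ⟨K, q, hK, hq, hq1, hmain⟩ := exists_wassersteinDist_le_fourierDist_rpow d hρ hM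
  set A : ℝ := (4 * (1 + M)) ^ (1 / 2 : ℝ) with hA
  have hA1 : 1 ≤ A := Real.one_le_rpow (by linarith) (by norm_num)
  have hA0 : 0 < A := by positivity
  have hA' : (4 * (1 + ENNReal.ofReal M)) ^ (1 / 2 : ℝ) = ENNReal.ofReal A := by
    rw [hA, ← ENNReal.ofReal_rpow_of_nonneg (by positivity) (by norm_num),
      ENNReal.ofReal_mul (by norm_num), ENNReal.ofReal_add zero_le_one hM.le]
    norm_num
  -- `A ≥ 1` lets the single factor `A` also cover the barycenter and mass terms; in the upper bound
  -- the extra `1` pays for them through the linear term.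
  refine ⟨A⁻¹, K + 1, q, by positivity, by positivity, hq, hq1, ?_⟩
  intro μ ν hμ hν mμ mν
  have pμ := isProbabilityMeasure_centeredNormalized hμ
  have pν := isProbabilityMeasure_centeredNormalized hν
  rw [← lintegral_centeredNormalized μ (f := fun x => ‖x‖ₑ ^ (2 + ρ)) (by fun_prop)] at mμ
  rw [← lintegral_centeredNormalized ν (f := fun x => ‖x‖ₑ ^ (2 + ρ)) (by fun_prop)] at mν
  have sμ := lintegral_enorm_sq_le_one_add hρ mμ
  have sν := lintegral_enorm_sq_le_one_add hρ mν
  have hB0 : 1 + ENNReal.ofReal M ≠ 0 := by simp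
  have hBt : 1 + ENNReal.ofReal M < ∞ := by simp
  have hW := wassersteinDist_le_of_moments sμ sν
  have hF := fourierDist_le_mul_wassersteinDist hB0 hBt sμ sν
    (integral_id_centeredNormalized hρ hμ) (integral_id_centeredNormalized hρ hν)
  have hWF := hmain _ _ mμ mν
  rw [hA'] at hW hF
  unfold genFourierDist genWassersteinDist
  set F := fourierDist (centeredNormalized μ) (centeredNormalized ν)
  set W := wassersteinDist (centeredNormalized μ) (centeredNormalized ν)
  set e₁ := ENNReal.ofReal ‖barycenter μ - barycenter ν‖
  set e₂ := ENNReal.ofReal |totalMass μ - totalMass ν|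
  have he₁ : e₁ < ∞ := ENNReal.ofReal_lt_top
  have he₂ : e₂ < ∞ := ENNReal.ofReal_lt_top
  have hWt : W < ∞ := hW.trans_lt ENNReal.ofReal_lt_top
  have hFt : F < ∞ := hF.trans_lt (ENNReal.mul_lt_top ENNReal.ofReal_lt_top hWt)
  refine ⟨by simp [hFt, he₁, he₂], by simp [hWt, he₁, he₂], ?_, ?_⟩
  · have hA1' : 1 ≤ ENNReal.ofReal A := ENNReal.one_le_ofReal.2 hA1
    calc ENNReal.ofReal A⁻¹ * (F + e₁ + e₂)
        ≤ ENNReal.ofReal A⁻¹ * (ENNReal.ofReal A * W + ENNReal.ofReal A * e₁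
            + ENNReal.ofReal A * e₂) := by
          gcongr
          · exact le_mul_of_one_le_left zero_le hA1'
          · exact le_mul_of_one_le_left zero_le hA1'
      _ = (ENNReal.ofReal A⁻¹ * ENNReal.ofReal A) * (W + e₁ + e₂) := by ring
      _ = W + e₁ + e₂ := by
          rw [← ENNReal.ofReal_mul (by positivity), inv_mul_cancel₀ hA0.ne', ENNReal.ofReal_one,
            one_mul]
  · rw [ENNReal.ofReal_add hK.le zero_le_one, ENNReal.ofReal_one, add_mul, one_mul, add_assoc W]
    gcongr ?_ + ?_
    · refine hWF.trans ?_
      have hle : F ≤ F + e₁ + e₂ := by rw [add_assoc]; exact le_self_add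
      gcongr
    · refine le_trans ?_ le_add_self
      rw [add_assoc]
      exact le_add_self
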